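/- Let $\{X_t\}_{t\in\mathbb Z}$ be a sequence of independent and identically distributed real random variables with distribution function $F$. Assume that $F$ is twice differentiable on $\mathbb R$ and write $f=F'$. Assume moreover that $$\sup_{x\in\mathbb R}\big(f(x)+|f'(x)|\big)<\infty ,$$ and that for some fixed $\lambda>18/5$ there is a constant $C$ with $\mathbb P(|X_1|>x)\le C\,x^{-\lambda}$ for all $x>0$. Fix $\beta\in(0,1)$. For a distribution function $G$ let $G^-(\beta)=\inf\{x\in\mathbb R : G(x)\ge\beta\}$, put $q_\beta=F^-(\beta)$, and assume $f(q_\beta)>0$. For integers $i<j$ let $$\hat F_i^j(z)=\frac1{j-i+1}\sum_{t=i}^{j} I\{X_t\le z\}\quad (z\in\mathbb R),\qquad [\hat q_\beta]_i^j=(\hat F_i^j)^-(\beta),$$ be the empirical distribution function and the empirical $\beta$-quantile of the subsample $X_i,\dots,X_j$, and let $$R_{i,j}=[\hat q_\beta]_i^j-q_\beta-\frac{\beta-\hat F_i^j(q_\beta)}{f(q_\beta)}$$ be the remainder of the Bahadur expansion. Then $$\frac1{\sqrt n}\max_{1\le i<j\le n}(j-i+1)\,|R_{i,j}|=o_{\mathbb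 P}(1)\qquad(n\to\infty),$$ that is, the left-hand side converges to $0$ in probability. -/

import Mathlib

open MeasureTheory ProbabilityTheory Filter Topology

noncomputable section

/-- The quantile functional `G ↦ G⁻(β) = inf {x ∈ ℝ | G x ≥ β}`. -/
def quantile (β : ℝ) (G : ℝ → ℝ) : ℝ :=
  sInf {x : ℝ | β ≤ G x}

/-- The empirical distribution function of the observations `x i, …, x j`:
`z ↦ (j - i + 1)⁻¹ ∑_{t = i}^{j} 1{x t ≤ z}`. -/
def empiricalCDF (x : ℤ → ℝ) (i j : ℤ) (z : ℝ) : ℝ :=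
  (1 / ((j : ℝ) - (i : ℝ) + 1)) *
    ∑ t ∈ Finset.Icc i j, Set.indicator {y : ℝ | y ≤ z} (fun _ => (1 : ℝ)) (x t)

/-- The remainder of the Bahadur expansion of the empirical `β`-quantile of the observations
`x i, …, x j` around the `β`-quantile of the distribution function `F` with density `deriv F`. -/
def bahadurRemainder (F : ℝ → ℝ) (β : ℝ) (x : ℤ → ℝ) (i j : ℤ) : ℝ :=
  quantile β (empiricalCDF x i j) - quantile β F
    - (β - empiricalCDF x i j (quantile β F)) / deriv F (quantile β F)

/-- `max_{1 ≤ i < j ≤ n} (j - i + 1) |R_{i,j}|`. The set is finite, and it is nonempty for `2 ≤ n`,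
so the supremum is a maximum; for `n ≤ 1` the value is `sSup ∅ = 0`. -/
def maxWeightedRemainder (F : ℝ → ℝ) (β : ℝ) (x : ℤ → ℝ) (n : ℕ) : ℝ :=
  sSup ((fun p : ℤ × ℤ => ((p.2 : ℝ) - (p.1 : ℝ) + 1) * |bahadurRemainder F β x p.1 p.2|) ''
    {p : ℤ × ℤ | 1 ≤ p.1 ∧ p.1 < p.2 ∧ p.2 ≤ (n : ℤ)})

end

/-! Split the blocks by their length `k = j - i + 1` at `n^(1/5)`.

Short blocks: the remainder is at most the largest `|X t|` plus a constant
(`abs_bahadurRemainder_le`). The moment tail makes `max |X t| ≤ (ε/2) n^(3/10)` with high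
probability, so `k |R| < ε n^(1/5) n^(3/10) = ε √n`.

Long blocks: `|R| > ε/√k` has probability at most `k^(-11)` (`eventually_bahadurRemainder_tail_le`),
which survives a union over at most `n²` pairs. This event puts the number of observations below a
point `q + D` on the wrong side of `kβ`, where `D` depends on the count at `q`
(`exists_sign_of_lt_abs_bahadurRemainder`). That count is an integer: a Chernoff bound confines it
to within `k^(5/8)` of `kβ`, and a union over its values replaces `D` by constants of order
`k^(-3/8)`. For each constant the count between `q` and `q + D` has variance of order at most
`k^(5/8)`, while the event forces a deviation of order `√k`, so the probability is exponentially
small in `k^(1/8)`. Powers of `w = k^(1/8)` express all these scales. -/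

/-! ### A Chernoff bound for sums of bounded variables -/

/-- From `exp y ≤ 1 + y + y²` for `|y| ≤ 1`. Keeping the second moment `v` in the exponent is what
exploits the small variance of increments; `s` is left free for the caller. -/
theorem sum_tail_le_exp {Ω ι : Type*} [MeasurableSpace Ω] {μ : Measure Ω}
    [IsProbabilityMeasure μ] {Y : ι → Ω → ℝ} (hm : ∀ t, Measurable (Y t)) (hY : iIndepFun Y μ)
    (hb : ∀ t ω, |Y t ω| ≤ 1) {e v s u a : ℝ} (he : ∀ t, ∫ ω, Y t ω ∂μ = e)
    (hv : ∀ t, ∫ ω, Y t ω ^ 2 ∂μ ≤ v) (hs0 : 0 ≤ s) (hs1 : s ≤ 1) (A : Finset ι)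
    (hu : A.card * e + u ≤ a) :
    μ.real {ω | a ≤ ∑ t ∈ A, Y t ω} ≤ Real.exp (-(s * u) + A.card * (s ^ 2 * v)) := by
  have hint : ∀ t, Integrable (Y t) μ := fun t =>
    Integrable.of_bound (hm t).aestronglyMeasurable 1 (ae_of_all _ fun ω => by simpa using hb t ω)
  have hint2 : ∀ t, Integrable (fun ω => Y t ω ^ 2) μ := fun t =>
    Integrable.of_bound ((hm t).pow_const 2).aestronglyMeasurable 1 (ae_of_all _ fun ω => by
      have := hb t ω
      rw [Real.norm_eq_abs, abs_pow]
      exact pow_le_one₀ (abs_nonneg _) this)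
  have hsy : ∀ t ω, |s * Y t ω| ≤ 1 := fun t ω => by
    rw [abs_mul, abs_of_nonneg hs0]
    exact mul_le_one₀ hs1 (abs_nonneg _) (hb t ω)
  have hmgf : ∀ t, mgf (Y t) μ s ≤ Real.exp (s * e + s ^ 2 * v) := by
    intro t
    have h1 : mgf (Y t) μ s ≤ ∫ ω, (1 + s * Y t ω + s ^ 2 * Y t ω ^ 2) ∂μ := by
      refine integral_mono_of_nonneg (ae_of_all _ fun ω => (Real.exp_pos _).le)
        (((integrable_const _).add ((hint t).const_mul s)).add ((hint2 t).const_mul _))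
        (ae_of_all _ fun ω => ?_)
      have := (abs_le.1 (Real.abs_exp_sub_one_sub_id_le (hsy t ω))).2
      simp only
      nlinarith
    have h2 : ∫ ω, (1 + s * Y t ω + s ^ 2 * Y t ω ^ 2) ∂μ
        = 1 + s * e + s ^ 2 * ∫ ω, Y t ω ^ 2 ∂μ := by
      have hI : Integrable (fun ω => 1 + s * Y t ω) μ :=
        (integrable_const _).add ((hint t).const_mul s)
      rw [integral_add hI ((hint2 t).const_mul _),
        integral_add (integrable_const _) ((hint t).const_mul s), integral_const_mul,
        integral_const_mul, he]
      simp
    have h3 := Real.add_one_le_exp (s * e + s ^ 2 * v)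
    have h4 := mul_le_mul_of_nonneg_left (hv t) (sq_nonneg s)
    linarith
  have hexp : Integrable (fun ω => Real.exp (s * ∑ t ∈ A, Y t ω)) μ := by
    refine Integrable.of_bound (by fun_prop) (Real.exp (A.card)) (ae_of_all _ fun ω => ?_)
    rw [Real.norm_eq_abs, abs_of_pos (Real.exp_pos _), Real.exp_le_exp, Finset.mul_sum]
    calc ∑ t ∈ A, s * Y t ω ≤ ∑ t ∈ A, 1 :=
          Finset.sum_le_sum fun t _ => (abs_le.1 (hsy t ω)).2
      _ = A.card := by simp
  have hsum : (∑ t ∈ A, Y t) = fun ω => ∑ t ∈ A, Y t ω := by ext ω; simp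
  have h := measure_ge_le_exp_mul_mgf (μ := μ) (X := fun ω => ∑ t ∈ A, Y t ω) a hs0 hexp
  have h5 := hY.mgf_sum hm A (t := s)
  rw [hsum] at h5
  rw [h5] at h
  refine h.trans ?_
  calc Real.exp (-s * a) * ∏ t ∈ A, mgf (Y t) μ s
      ≤ Real.exp (-s * a) * ∏ t ∈ A, Real.exp (s * e + s ^ 2 * v) := by
        gcongr with t
        · intro i _; exact mgf_nonneg
        · exact hmgf t
    _ = Real.exp (-s * a + A.card * (s * e + s ^ 2 * v)) := by
        rw [Finset.prod_const, ← Real.exp_nat_mul, ← Real.exp_add]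
    _ ≤ _ := by
        rw [Real.exp_le_exp]
        nlinarith

/-! ### Quantiles of empirical distribution functions -/

theorem one_div_mul_le_iff_of_lt {i j : ℤ} (hij : i < j) {a b : ℝ} :
    b ≤ 1 / ((j : ℝ) - (i : ℝ) + 1) * a ↔ ((j : ℝ) - i + 1) * b ≤ a := by
  have : (i : ℝ) < j := by exact_mod_cast hij
  rw [one_div, ← div_eq_inv_mul, le_div_iff₀ (by linarith), mul_comm]

theorem card_Icc_cast {i j : ℤ} (hij : i < j) :
    ((Finset.Icc i j).card : ℝ) = (j : ℝ) - i + 1 := by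
  have h : ((Finset.Icc i j).card : ℤ) = j - i + 1 := by
    rw [Int.card_Icc, Int.toNat_of_nonneg (by omega)]; ring
  exact_mod_cast h

theorem empiricalCDF_mono {i j : ℤ} (hij : i < j) (x : ℤ → ℝ) :
    Monotone (empiricalCDF x i j) := by
  intro a b hab
  have : (i : ℝ) < j := by exact_mod_cast hij
  unfold empiricalCDF
  refine mul_le_mul_of_nonneg_left (Finset.sum_le_sum fun t _ => ?_)
    (one_div_nonneg.2 (by linarith))
  exact Set.indicator_le_indicator_of_subset (fun y (hy : y ≤ a) => hy.trans hab)
    (fun _ => zero_le_one) _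

theorem empiricalCDF_eq_one {i j : ℤ} (hij : i < j) {x : ℤ → ℝ} {B : ℝ}
    (hB : ∀ t ∈ Finset.Icc i j, x t ≤ B) : empiricalCDF x i j B = 1 := by
  have h : (i : ℝ) < j := by exact_mod_cast hij
  unfold empiricalCDF
  rw [Finset.sum_congr rfl fun t ht =>
    Set.indicator_of_mem (show x t ∈ {y : ℝ | y ≤ B} from hB t ht) _, Finset.sum_const,
    nsmul_eq_mul, card_Icc_cast hij]
  have : (j : ℝ) - i + 1 ≠ 0 := by linarith
  field_simp

theorem empiricalCDF_eq_zero {i j : ℤ} {x : ℤ → ℝ} {B : ℝ}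
    (hB : ∀ t ∈ Finset.Icc i j, B < x t) : empiricalCDF x i j B = 0 := by
  unfold empiricalCDF
  rw [Finset.sum_eq_zero fun t ht => Set.indicator_of_notMem
    (show x t ∉ {y : ℝ | y ≤ B} from not_le.2 (hB t ht)) _, mul_zero]

theorem exists_abs_le_of_Icc (x : ℤ → ℝ) (i j : ℤ) :
    ∃ B, ∀ t ∈ Finset.Icc i j, |x t| ≤ B :=
  ⟨∑ t ∈ Finset.Icc i j, |x t|, fun _ ht =>
    Finset.single_le_sum (f := fun t => |x t|) (fun _ _ => abs_nonneg _) ht⟩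

theorem neg_le_of_le_empiricalCDF {i j : ℤ} {x : ℤ → ℝ} {B β y : ℝ} (hβ : 0 < β)
    (hB : ∀ t ∈ Finset.Icc i j, |x t| ≤ B) (hy : β ≤ empiricalCDF x i j y) : -B ≤ y := by
  by_contra h
  rw [empiricalCDF_eq_zero fun t ht => (not_le.1 h).trans_le (abs_le.1 (hB t ht)).1] at hy
  linarith

theorem quantile_empiricalCDF_le {i j : ℤ} {x : ℤ → ℝ} {β y : ℝ} (hβ : 0 < β)
    (hy : β ≤ empiricalCDF x i j y) : quantile β (empiricalCDF x i j) ≤ y := by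
  obtain ⟨B, hB⟩ := exists_abs_le_of_Icc x i j
  exact csInf_le ⟨-B, fun z hz => neg_le_of_le_empiricalCDF hβ hB hz⟩ hy

/-- The strict inequality provides a point of the level set below `y`, so the infimum need not be
attained. -/
theorem le_empiricalCDF_of_quantile_lt {i j : ℤ} (hij : i < j) {x : ℤ → ℝ} {β y : ℝ}
    (hβ : β < 1) (hy : quantile β (empiricalCDF x i j) < y) : β ≤ empiricalCDF x i j y := by
  obtain ⟨B, hB⟩ := exists_abs_le_of_Icc x i j
  obtain ⟨z, hz, hzy⟩ := exists_lt_of_csInf_lt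
    ⟨B, (hβ.le.trans_eq (empiricalCDF_eq_one hij fun t ht => (abs_le.1 (hB t ht)).2).symm :
      β ≤ empiricalCDF x i j B)⟩ hy
  exact le_trans hz (empiricalCDF_mono hij x hzy.le)

theorem abs_quantile_empiricalCDF_le {i j : ℤ} (hij : i < j) {x : ℤ → ℝ} {β B : ℝ} (hβ0 : 0 < β)
    (hβ1 : β < 1) (hB : ∀ t ∈ Finset.Icc i j, |x t| ≤ B) :
    |quantile β (empiricalCDF x i j)| ≤ B := by
  have h1 : β ≤ empiricalCDF x i j B :=
    hβ1.le.trans_eq (empiricalCDF_eq_one hij fun t ht => (abs_le.1 (hB t ht)).2).symm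
  exact abs_le.2 ⟨le_csInf ⟨B, h1⟩ fun z hz => neg_le_of_le_empiricalCDF hβ0 hB hz,
    quantile_empiricalCDF_le hβ0 h1⟩

theorem empiricalCDF_mem_Icc {i j : ℤ} (hij : i < j) (x : ℤ → ℝ) (y : ℝ) :
    empiricalCDF x i j y ∈ Set.Icc (0 : ℝ) 1 := by
  obtain ⟨B, hB⟩ := exists_abs_le_of_Icc x i j
  constructor
  · rw [← empiricalCDF_eq_zero (i := i) (j := j) (x := x) (B := min y (-B - 1)) fun t ht => by
      have := (abs_le.1 (hB t ht)).1
      exact (min_le_right _ _).trans_lt (by linarith)]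
    exact empiricalCDF_mono hij x (min_le_left _ _)
  · rw [← empiricalCDF_eq_one hij (x := x) (B := max y B) fun t ht =>
      (abs_le.1 (hB t ht)).2.trans (le_max_right _ _)]
    exact empiricalCDF_mono hij x (le_max_left _ _)

theorem abs_bahadurRemainder_le {F : ℝ → ℝ} {i j : ℤ} (hij : i < j) {x : ℤ → ℝ} {β B : ℝ}
    (hβ0 : 0 < β) (hβ1 : β < 1) (hf : 0 < deriv F (quantile β F))
    (hB : ∀ t ∈ Finset.Icc i j, |x t| ≤ B) :
    |bahadurRemainder F β x i j| ≤ B + |quantile β F| + 1 / deriv F (quantile β F) := by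
  have h1 := abs_quantile_empiricalCDF_le hij hβ0 hβ1 hB
  have h2 := empiricalCDF_mem_Icc hij x (quantile β F)
  have h3 : |(β - empiricalCDF x i j (quantile β F)) / deriv F (quantile β F)|
      ≤ 1 / deriv F (quantile β F) := by
    rw [abs_div, abs_of_pos hf]
    gcongr
    rw [abs_le]
    constructor <;> linarith [h2.1, h2.2]
  unfold bahadurRemainder
  refine (abs_sub _ _).trans ?_
  refine add_le_add ((abs_sub _ _).trans ?_) h3
  gcongr

/-! ### Distribution functions -/

section

variable {Ω : Type*} [MeasurableSpace Ω] {μ : Measure Ω} {X : ℤ → Ω → ℝ}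
  {F : ℝ → ℝ}

theorem measurable_indicator_le (a : ℝ) :
    Measurable ({y : ℝ | y ≤ a}.indicator fun _ => (1 : ℝ)) :=
  measurable_const.indicator measurableSet_Iic

theorem integral_indicator_le (hmeas : ∀ t, Measurable (X t))
    (hident : ∀ t, IdentDistrib (X t) (X 1) μ μ) (hF : ∀ x, F x = μ.real {ω | X 1 ω ≤ x})
    (t : ℤ) (a : ℝ) : ∫ ω, {y : ℝ | y ≤ a}.indicator (fun _ => (1 : ℝ)) (X t ω) ∂μ = F a := by
  have h := ((hident t).comp (measurable_indicator_le a)).integral_eq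
  simp only [Function.comp_apply] at h
  rw [h, hF]
  have : (fun ω => {y : ℝ | y ≤ a}.indicator (fun _ => (1 : ℝ)) (X 1 ω))
      = {ω | X 1 ω ≤ a}.indicator fun _ => 1 := by
    ext ω; simp [Set.indicator]
  rw [this, integral_indicator (measurableSet_le (hmeas 1) measurable_const)]
  simp

variable [IsProbabilityMeasure μ]

theorem monotone_of_eq_measureReal (hF : ∀ x, F x = μ.real {ω | X 1 ω ≤ x}) : Monotone F := by
  intro a b hab
  rw [hF, hF]
  exact measureReal_mono fun ω (hω : X 1 ω ≤ a) => hω.trans hab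

theorem apply_quantile (hm : Measurable (X 1)) (hF : ∀ x, F x = μ.real {ω | X 1 ω ≤ x})
    (hc : Continuous F) {β : ℝ} (hβ0 : 0 < β) (hβ1 : β < 1) : F (quantile β F) = β := by
  have : IsProbabilityMeasure (μ.map (X 1)) := Measure.isProbabilityMeasure_map hm.aemeasurable
  have hcdf : F = cdf (μ.map (X 1)) := by
    ext x
    rw [cdf_eq_real, map_measureReal_apply hm measurableSet_Iic, hF]
    rfl
  have hmono := monotone_of_eq_measureReal hF
  have htop : Tendsto F atTop (𝓝 1) := hcdf ▸ tendsto_cdf_atTop _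
  have hbot : Tendsto F atBot (𝓝 0) := hcdf ▸ tendsto_cdf_atBot _
  obtain ⟨a, ha⟩ := (hbot.eventually_lt_const hβ0).exists
  obtain ⟨b, hb⟩ := (htop.eventually_const_lt hβ1).exists
  have hbdd : BddBelow {x | β ≤ F x} := ⟨a, fun x hx => by
    by_contra h
    exact absurd (hmono (not_le.1 h).le) (not_le.2 (ha.trans_le hx))⟩
  have hmem : β ≤ F (quantile β F) :=
    (isClosed_le continuous_const hc).csInf_mem ⟨b, hb.le⟩ hbdd
  obtain ⟨c, hc'⟩ : ∃ c, F c = β := by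
    obtain ⟨c, -, hc'⟩ := intermediate_value_Icc (a := min a b) (b := b) (min_le_right _ _)
      hc.continuousOn ⟨(hmono (min_le_left _ _)).trans ha.le, hb.le⟩
    exact ⟨c, hc'⟩
  exact le_antisymm ((hmono (csInf_le hbdd hc'.ge)).trans_eq hc') hmem

/-- The mean value inequality applied twice, to `deriv F` and then to `F x - deriv F q * x`;
continuity of the second derivative is not needed. -/
theorem abs_sub_sub_deriv_mul_le {F : ℝ → ℝ} (hd : Differentiable ℝ F)
    (hd2 : Differentiable ℝ (deriv F)) {B : ℝ} (hB : ∀ x, |deriv (deriv F) x| ≤ B) (q D : ℝ) :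
    |F (q + D) - F q - deriv F q * D| ≤ B * D ^ 2 := by
  have h1 : ∀ x, |deriv F x - deriv F q| ≤ B * |x - q| := fun x =>
    convex_univ.norm_image_sub_le_of_norm_deriv_le (fun x _ => hd2 x) (fun x _ => hB x)
      (Set.mem_univ q) (Set.mem_univ x)
  have hB0 : 0 ≤ B := (abs_nonneg _).trans (hB 0)
  have hg : ∀ x, HasDerivAt (fun x => F x - deriv F q * x) (deriv F x - deriv F q) x := fun x => by
    have h := (hd x).hasDerivAt.sub ((hasDerivAt_id x).const_mul (deriv F q))
    rw [mul_one] at h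
    exact h
  have h2 := (convex_uIcc q (q + D)).norm_image_sub_le_of_norm_deriv_le (C := B * |D|)
    (fun x _ => (hg x).differentiableAt) (fun x hx => by
      rw [(hg x).deriv]
      refine (h1 x).trans (mul_le_mul_of_nonneg_left ?_ hB0)
      simpa using Set.abs_sub_left_of_mem_uIcc hx) Set.left_mem_uIcc Set.right_mem_uIcc
  simp only [Real.norm_eq_abs, add_sub_cancel_left] at h2
  rw [mul_assoc, ← sq, sq_abs] at h2
  convert h2 using 2
  ring

/-! ### Deviations of empirical counts -/

theorem integrable_indicator_le (hmeas : ∀ t, Measurable (X t)) (t : ℤ) (a : ℝ) :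
    Integrable (fun ω => {y : ℝ | y ≤ a}.indicator (fun _ => (1 : ℝ)) (X t ω)) μ :=
  Integrable.of_bound ((measurable_indicator_le a).comp (hmeas t)).aestronglyMeasurable 1
    (ae_of_all _ fun ω => by
      by_cases h : X t ω ≤ a <;> simp [Set.indicator, h])

theorem count_tail_le (hmeas : ∀ t, Measurable (X t)) (hindep : iIndepFun X μ)
    (hident : ∀ t, IdentDistrib (X t) (X 1) μ μ) (hF : ∀ x, F x = μ.real {ω | X 1 ω ≤ x})
    {σ : ℝ} (hσ : |σ| = 1) (q : ℝ) {s u a : ℝ} (hs0 : 0 ≤ s) (hs1 : s ≤ 1) (A : Finset ℤ)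
    (hu : A.card * (σ * F q) + u ≤ a) :
    μ.real {ω | a ≤ σ * ∑ t ∈ A, {y : ℝ | y ≤ q}.indicator (fun _ => (1 : ℝ)) (X t ω)}
      ≤ Real.exp (-(s * u) + A.card * s ^ 2) := by
  have hσ2 : σ ^ 2 = 1 := by rw [← sq_abs, hσ, one_pow]
  have h := sum_tail_le_exp (μ := μ)
    (Y := fun t ω => σ * {y : ℝ | y ≤ q}.indicator (fun _ => (1 : ℝ)) (X t ω)) (v := 1)
    (fun t => ((measurable_indicator_le q).comp (hmeas t)).const_mul σ)
    (hindep.comp (fun _ x => σ * {y : ℝ | y ≤ q}.indicator (fun _ => (1 : ℝ)) x)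
      fun _ => (measurable_indicator_le q).const_mul σ)
    (fun t ω => by by_cases h : X t ω ≤ q <;> simp [Set.indicator, h, hσ])
    (fun t => by rw [integral_const_mul, integral_indicator_le hmeas hident hF])
    (fun t => by
      refine (integral_mono_of_nonneg (ae_of_all _ fun ω => sq_nonneg _) (integrable_const 1)
        (ae_of_all _ fun ω => ?_)).trans_eq (by simp)
      by_cases h : X t ω ≤ q <;> simp [Set.indicator, h, hσ2]) hs0 hs1 A hu
  simpa only [← Finset.mul_sum, mul_one] using h

/-- The difference of two indicators is, up to sign, the indicator of an interval, so its second
moment is only `|F p - F q|`. The sign `σ` covers both tails. -/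
theorem count_increment_tail_le (hmeas : ∀ t, Measurable (X t)) (hindep : iIndepFun X μ)
    (hident : ∀ t, IdentDistrib (X t) (X 1) μ μ) (hF : ∀ x, F x = μ.real {ω | X 1 ω ≤ x})
    {σ : ℝ} (hσ : |σ| = 1) (p q : ℝ) {s u a : ℝ} (hs0 : 0 ≤ s) (hs1 : s ≤ 1) (A : Finset ℤ)
    (hu : A.card * (σ * (F p - F q)) + u ≤ a) :
    μ.real {ω | a ≤ σ * (∑ t ∈ A, {y : ℝ | y ≤ p}.indicator (fun _ => (1 : ℝ)) (X t ω)
      - ∑ t ∈ A, {y : ℝ | y ≤ q}.indicator (fun _ => (1 : ℝ)) (X t ω))}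
      ≤ Real.exp (-(s * u) + A.card * (s ^ 2 * |F p - F q|)) := by
  have hσ2 : σ ^ 2 = 1 := by rw [← sq_abs, hσ, one_pow]
  have hmono := monotone_of_eq_measureReal hF
  have hint := fun t a => integrable_indicator_le (μ := μ) hmeas t a
  have hsq : ∀ t, ∫ ω, (σ * ({y : ℝ | y ≤ p}.indicator (fun _ => (1 : ℝ)) (X t ω)
      - {y : ℝ | y ≤ q}.indicator (fun _ => (1 : ℝ)) (X t ω))) ^ 2 ∂μ ≤ |F p - F q| := by
    intro t
    rcases le_total p q with h | h
    · rw [abs_sub_comm, abs_of_nonneg (sub_nonneg.2 (hmono h)),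
        ← integral_indicator_le hmeas hident hF t p, ← integral_indicator_le hmeas hident hF t q,
        ← integral_sub (hint t q) (hint t p)]
      refine (integral_congr_ae (ae_of_all _ fun ω => ?_)).le
      by_cases h1 : X t ω ≤ p
      · simp [Set.indicator, h1, h1.trans h]
      · by_cases h2 : X t ω ≤ q <;> simp [Set.indicator, h1, h2, hσ2]
    · rw [abs_of_nonneg (sub_nonneg.2 (hmono h)),
        ← integral_indicator_le hmeas hident hF t p, ← integral_indicator_le hmeas hident hF t q,
        ← integral_sub (hint t p) (hint t q)]
      refine (integral_congr_ae (ae_of_all _ fun ω => ?_)).le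
      by_cases h1 : X t ω ≤ q
      · simp [Set.indicator, h1, h1.trans h]
      · by_cases h2 : X t ω ≤ p <;> simp [Set.indicator, h1, h2, hσ2]
  have h := sum_tail_le_exp (μ := μ)
    (Y := fun t ω => σ * ({y : ℝ | y ≤ p}.indicator (fun _ => (1 : ℝ)) (X t ω)
      - {y : ℝ | y ≤ q}.indicator (fun _ => (1 : ℝ)) (X t ω)))
    (fun t => (((measurable_indicator_le p).comp (hmeas t)).sub
      ((measurable_indicator_le q).comp (hmeas t))).const_mul σ)
    (hindep.comp (fun _ x => σ * ({y : ℝ | y ≤ p}.indicator (fun _ => (1 : ℝ)) x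
      - {y : ℝ | y ≤ q}.indicator (fun _ => (1 : ℝ)) x))
      fun _ => ((measurable_indicator_le p).sub (measurable_indicator_le q)).const_mul σ)
    (fun t ω => by
      by_cases h : X t ω ≤ p <;> by_cases h' : X t ω ≤ q <;> simp [Set.indicator, h, h', hσ])
    (fun t => by
      rw [integral_const_mul, integral_sub (hint t p) (hint t q),
        integral_indicator_le hmeas hident hF, integral_indicator_le hmeas hident hF])
    hsq hs0 hs1 A hu
  simpa only [← Finset.mul_sum, Finset.sum_sub_distrib] using h

end

/-! ### Tail bound for a single remainder -/

/-- The number of observations among `x i, …, x j` that are at most `q`. -/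
noncomputable def countLE (x : ℤ → ℝ) (i j : ℤ) (q : ℝ) : ℝ :=
  ∑ t ∈ Finset.Icc i j, {y : ℝ | y ≤ q}.indicator (fun _ => (1 : ℝ)) (x t)

theorem exists_nat_countLE_eq (x : ℤ → ℝ) (i j : ℤ) (q : ℝ) :
    ∃ m ≤ (Finset.Icc i j).card, countLE x i j q = m := by
  refine ⟨((Finset.Icc i j).filter fun t => x t ≤ q).card, Finset.card_filter_le _ _, ?_⟩
  rw [Finset.card_filter]
  push_cast
  exact Finset.sum_congr rfl fun t _ => by simp [Set.indicator]

theorem exists_sign_of_lt_abs_bahadurRemainder {F : ℝ → ℝ} {i j : ℤ} (hij : i < j) {x : ℤ → ℝ}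
    {β r k : ℝ} (hβ0 : 0 < β) (hβ1 : β < 1) (hf : 0 < deriv F (quantile β F))
    (hk : (j : ℝ) - i + 1 = k) (hr : r < |bahadurRemainder F β x i j|) :
    ∃ σ ∈ ({1, -1} : Finset ℝ), σ * countLE x i j (quantile β F +
      ((k * β - countLE x i j (quantile β F)) / (k * deriv F (quantile β F)) + σ * r))
      ≤ σ * (k * β) := by
  set q := quantile β F
  set f := deriv F q
  have hk0 : 0 < k := by
    have : (i : ℝ) < j := by exact_mod_cast hij
    linarith
  have hN : ∀ y, empiricalCDF x i j y = 1 / k * countLE x i j y := fun y => by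
    rw [← hk]; rfl
  have hle : ∀ y, β ≤ empiricalCDF x i j y ↔ k * β ≤ countLE x i j y := fun y => by
    rw [← hk]; exact one_div_mul_le_iff_of_lt hij
  have hR : bahadurRemainder F β x i j = quantile β (empiricalCDF x i j) - q
      - (k * β - countLE x i j q) / (k * f) := by
    change quantile β (empiricalCDF x i j) - q - (β - empiricalCDF x i j q) / f = _
    rw [hN q]
    field_simp
  rw [hR] at hr
  -- A large positive remainder puts the empirical quantile above the shifted point, so too few
  -- observations lie below it; a large negative one gives the reverse.
  rcases lt_abs.1 hr with h | h
  · refine ⟨1, by simp, ?_⟩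
    rw [one_mul, one_mul, one_mul]
    by_contra hc
    have := quantile_empiricalCDF_le hβ0 ((hle _).2 (not_le.1 hc).le)
    linarith
  · refine ⟨-1, by simp, ?_⟩
    have := (hle _).1 (le_empiricalCDF_of_quantile_lt hij hβ1
      (y := q + ((k * β - countLE x i j q) / (k * f) + -1 * r)) (by linarith))
    linarith

section

variable {Ω : Type*} [MeasurableSpace Ω] {μ : Measure Ω} [IsProbabilityMeasure μ]
  {X : ℤ → Ω → ℝ} {F : ℝ → ℝ}

/-- Here `d` stands for one fixed value of `kβ` minus the count at `q`, so the evaluation point is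
deterministic. `hw2` makes the Taylor error at most half of the drift `f ε w ^ 4` produced by the
shift `ε / w ^ 4`. -/
theorem bahadur_increment_tail_le (hmeas : ∀ t, Measurable (X t)) (hindep : iIndepFun X μ)
    (hident : ∀ t, IdentDistrib (X t) (X 1) μ μ) (hF : ∀ x, F x = μ.real {ω | X 1 ω ≤ x})
    (hd : Differentiable ℝ F) (hd2 : Differentiable ℝ (deriv F)) {B : ℝ}
    (hB1 : ∀ x, |deriv F x| ≤ B) (hB2 : ∀ x, |deriv (deriv F) x| ≤ B) {q : ℝ}
    (hf : 0 < deriv F q) {ε : ℝ} (hε : 0 < ε) {w : ℝ} (hw : 1 ≤ w)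
    (hw2 : 2 * (B * (1 / deriv F q + ε) ^ 2) ≤ deriv F q * ε * w ^ 2)
    {i j : ℤ} (hk : ((Finset.Icc i j).card : ℝ) = w ^ 8) {σ : ℝ} (hσ : |σ| = 1) {d : ℝ}
    (hdw : |d| ≤ w ^ 5) :
    μ.real {ω | -(σ * d) ≤ σ * (countLE (fun t => X t ω) i j q - countLE (fun t => X t ω) i j
        (q + (d / (w ^ 8 * deriv F q) + σ * (ε / w ^ 4))))}
      ≤ Real.exp (B * (1 / deriv F q + ε) - deriv F q * ε / 2 * w) := by
  set f := deriv F q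
  set D := d / (w ^ 8 * f) + σ * (ε / w ^ 4) with hD
  set c := 1 / f + ε
  have hw0 : 0 < w := by linarith
  have hB0 : 0 ≤ B := (abs_nonneg _).trans (hB1 0)
  have hc0 : 0 < c := by positivity
  have hσ2 : σ ^ 2 = 1 := by rw [← sq_abs, hσ, one_pow]
  have hDabs : |D| ≤ c / w ^ 3 := by
    have h1 : |d / (w ^ 8 * f)| ≤ 1 / f / w ^ 3 := by
      rw [abs_div, abs_of_pos (by positivity : 0 < w ^ 8 * f), div_div,
        div_le_div_iff₀ (by positivity) (by positivity)]
      have : f * w ^ 3 * |d| ≤ f * w ^ 3 * w ^ 5 := by gcongr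
      nlinarith
    have h2 : |σ * (ε / w ^ 4)| ≤ ε / w ^ 3 := by
      rw [abs_mul, hσ, one_mul, abs_of_pos (by positivity)]
      gcongr
      · norm_num
    calc |D| ≤ _ := abs_add_le _ _
      _ ≤ 1 / f / w ^ 3 + ε / w ^ 3 := add_le_add h1 h2
      _ = c / w ^ 3 := by rw [← add_div]
  have hDsq : w ^ 8 * D ^ 2 ≤ c ^ 2 * w ^ 2 := by
    have : D ^ 2 ≤ (c / w ^ 3) ^ 2 := by rw [← sq_abs]; gcongr
    calc w ^ 8 * D ^ 2 ≤ w ^ 8 * (c / w ^ 3) ^ 2 := by gcongr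
      _ = c ^ 2 * w ^ 2 := by field_simp
  have htaylor := abs_sub_sub_deriv_mul_le hd hd2 hB2 q D
  have hlip : |F q - F (q + D)| ≤ B * (c / w ^ 3) := by
    have := convex_univ.norm_image_sub_le_of_norm_deriv_le (fun x _ => hd x) (fun x _ => hB1 x)
      (Set.mem_univ (q + D)) (Set.mem_univ q)
    rw [Real.norm_eq_abs, Real.norm_eq_abs, sub_add_cancel_left, abs_neg] at this
    exact this.trans (by gcongr)
  have hfD : w ^ 8 * (σ * (f * D)) = σ * d + f * ε * w ^ 4 := by
    rw [hD]
    field_simp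
    linear_combination (w ^ 4 * f * ε) * hσ2
  -- The linear part of the mean cancels `d` and leaves `f ε w ^ 4`; half of it absorbs the Taylor
  -- error of order `w ^ 2`.
  have hmean : w ^ 8 * (σ * (F q - F (q + D))) + f * ε / 2 * w ^ 4 ≤ -(σ * d) := by
    have h1 : σ * (F q - F (q + D)) ≤ -(σ * (f * D)) + B * D ^ 2 := by
      have h2 : |σ * (F (q + D) - F q - f * D)| ≤ B * D ^ 2 := by rwa [abs_mul, hσ, one_mul]
      linarith [(abs_le.1 h2).1]
    have h3 := mul_le_mul_of_nonneg_left h1 (by positivity : 0 ≤ w ^ 8)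
    have h4 := mul_le_mul_of_nonneg_left hDsq hB0
    have h5 := mul_le_mul_of_nonneg_right hw2 (by positivity : 0 ≤ w ^ 2)
    nlinarith
  -- With `s = 1 / w ^ 3` the gain `s * u` is of order `w` and the variance term stays bounded.
  have h := count_increment_tail_le (s := 1 / w ^ 3) (u := f * ε / 2 * w ^ 4)
    (a := -(σ * d)) hmeas hindep hident hF hσ q (q + D)
    (by positivity) (by rw [div_le_one (by positivity)]; exact one_le_pow₀ hw) (Finset.Icc i j)
    (by rw [hk]; exact hmean)
  refine h.trans ?_
  rw [Real.exp_le_exp, hk]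
  have h1 : 1 / w ^ 3 * (f * ε / 2 * w ^ 4) = f * ε / 2 * w := by field_simp
  have h2 : w ^ 8 * ((1 / w ^ 3) ^ 2 * |F q - F (q + D)|) ≤ B * c := by
    calc w ^ 8 * ((1 / w ^ 3) ^ 2 * |F q - F (q + D)|)
        ≤ w ^ 8 * ((1 / w ^ 3) ^ 2 * (B * (c / w ^ 3))) := by gcongr
      _ = B * c / w := by field_simp
      _ ≤ B * c := div_le_self (by positivity) hw
  linarith

theorem bahadurRemainder_tail_le (hmeas : ∀ t, Measurable (X t)) (hindep : iIndepFun X μ)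
    (hident : ∀ t, IdentDistrib (X t) (X 1) μ μ) (hF : ∀ x, F x = μ.real {ω | X 1 ω ≤ x})
    (hd : Differentiable ℝ F) (hd2 : Differentiable ℝ (deriv F)) {B : ℝ}
    (hB1 : ∀ x, |deriv F x| ≤ B) (hB2 : ∀ x, |deriv (deriv F) x| ≤ B) {β : ℝ} (hβ0 : 0 < β)
    (hβ1 : β < 1) (hf : 0 < deriv F (quantile β F)) {ε : ℝ} (hε : 0 < ε) {w : ℝ} (hw : 1 ≤ w)
    (hw2 : 2 * (B * (1 / deriv F (quantile β F) + ε) ^ 2) ≤ deriv F (quantile β F) * ε * w ^ 2)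
    {i j : ℤ} (hij : i < j) (hk : (j : ℝ) - i + 1 = w ^ 8) :
    μ.real {ω | ε / w ^ 4 < |bahadurRemainder F β (fun t => X t ω) i j|}
      ≤ 2 * (Real.exp (1 - w) + (w ^ 8 + 1) * Real.exp
        (B * (1 / deriv F (quantile β F) + ε) - deriv F (quantile β F) * ε / 2 * w)) := by
  have hcard := (card_Icc_cast hij).trans hk
  have hFq := apply_quantile (hmeas 1) hF hd.continuous hβ0 hβ1
  set q := quantile β F
  set f := deriv F q
  have hw0 : 0 < w := by linarith
  -- The typical values of the count at `q`.
  set G : Finset ℕ := (Finset.range ((Finset.Icc i j).card + 1)).filter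
    fun m => |w ^ 8 * β - m| ≤ w ^ 5
  have hGcard : (G.card : ℝ) ≤ w ^ 8 + 1 := by
    have : G.card ≤ (Finset.Icc i j).card + 1 :=
      (Finset.card_filter_le _ _).trans_eq (Finset.card_range _)
    rw [← hcard]
    exact_mod_cast this
  have hsub : {ω | ε / w ^ 4 < |bahadurRemainder F β (fun t => X t ω) i j|} ⊆
      ⋃ σ ∈ ({1, -1} : Finset ℝ),
        ({ω | σ * (w ^ 8 * β) + w ^ 5 ≤ σ * countLE (fun t => X t ω) i j q} ∪
        ⋃ m ∈ G, {ω | -(σ * (w ^ 8 * β - m)) ≤ σ * (countLE (fun t => X t ω) i j q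
          - countLE (fun t => X t ω) i j
            (q + ((w ^ 8 * β - m) / (w ^ 8 * f) + σ * (ε / w ^ 4))))}) := by
    intro ω hω
    obtain ⟨σ, hσ, h⟩ := exists_sign_of_lt_abs_bahadurRemainder hij hβ0 hβ1 hf hk hω
    obtain ⟨m, hm, hmN⟩ := exists_nat_countLE_eq (fun t => X t ω) i j q
    simp only [Set.mem_iUnion, Set.mem_union, Set.mem_ofPred_eq, exists_prop]
    by_cases hmd : |w ^ 8 * β - m| ≤ w ^ 5
    · refine ⟨σ, hσ, Or.inr ⟨m, Finset.mem_filter.2 ⟨Finset.mem_range.2 (by omega), hmd⟩, ?_⟩⟩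
      rw [← hmN]
      linarith
    · rcases lt_abs.1 (not_le.1 hmd) with h' | h'
      · exact ⟨-1, by simp, Or.inl (by rw [hmN]; linarith)⟩
      · exact ⟨1, by simp, Or.inl (by rw [hmN]; linarith)⟩
  have hone : ∀ σ ∈ ({1, -1} : Finset ℝ), |σ| = 1 := by
    intro σ hσ
    rcases Finset.mem_insert.1 hσ with rfl | h
    · simp
    · rw [Finset.mem_singleton.1 h]; simp
  have hH : ∀ σ ∈ ({1, -1} : Finset ℝ),
      μ.real {ω | σ * (w ^ 8 * β) + w ^ 5 ≤ σ * countLE (fun t => X t ω) i j q}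
        ≤ Real.exp (1 - w) := by
    intro σ hσ
    -- This `s` turns the exponent into exactly `-w + 1`; the centring uses `F q = β`.
    have h := count_tail_le (s := 1 / w ^ 4) (u := w ^ 5) (a := σ * (w ^ 8 * β) + w ^ 5)
      hmeas hindep hident hF (hone σ hσ) q
      (by positivity) (by rw [div_le_one (by positivity)]; exact one_le_pow₀ hw) (Finset.Icc i j)
      (by rw [hcard, hFq]; linarith)
    refine h.trans_eq ?_
    rw [hcard]
    congr 1
    field_simp
    ring
  refine (measureReal_mono hsub (measure_ne_top _ _)).trans ((measureReal_biUnion_finset_le _ _).trans ?_)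
  have hcard2 : (({1, -1} : Finset ℝ).card : ℝ) = 2 := by
    rw [Finset.card_pair (by norm_num)]; norm_num
  refine (Finset.sum_le_card_nsmul _ _ (Real.exp (1 - w) + (w ^ 8 + 1) * Real.exp
    (B * (1 / f + ε) - f * ε / 2 * w)) fun σ hσ => (measureReal_union_le _ _).trans ?_).trans_eq
    (by rw [nsmul_eq_mul, hcard2])
  refine add_le_add (hH σ hσ) ((measureReal_biUnion_finset_le _ _).trans ?_)
  refine (Finset.sum_le_card_nsmul _ _ _ fun m hm => bahadur_increment_tail_le hmeas hindep hident
    hF hd hd2 hB1 hB2 hf hε hw hw2 hcard (hone σ hσ) (Finset.mem_filter.1 hm).2).trans ?_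
  rw [nsmul_eq_mul]
  exact mul_le_mul_of_nonneg_right hGcard (Real.exp_pos _).le

/-- The exponent is `88 = 8 * 11`, so that the bound reads `k ^ (-11)` when `k = w ^ 8`. -/
theorem eventually_exp_bound_le (a : ℝ) {c : ℝ} (hc : 0 < c) :
    ∀ᶠ w : ℝ in atTop,
      2 * (Real.exp (1 - w) + (w ^ 8 + 1) * Real.exp (a - c * w)) ≤ (w ^ 88)⁻¹ := by
  have key : ∀ (n : ℕ) (a c : ℝ), 0 < c →
      Tendsto (fun w : ℝ => w ^ n * Real.exp (a - c * w)) atTop (𝓝 0) := by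
    intro n a c hc
    have h := ((Real.tendsto_pow_mul_exp_neg_atTop_nhds_zero n).comp
      (tendsto_id.const_mul_atTop hc)).const_mul (Real.exp a / c ^ n)
    rw [mul_zero] at h
    refine h.congr fun w => ?_
    simp only [Function.comp_apply, id]
    rw [sub_eq_add_neg, Real.exp_add, mul_pow]
    field_simp
  have h := ((key 88 1 1 one_pos).add ((key 96 a c hc).add (key 88 a c hc))).const_mul 2
  norm_num at h
  filter_upwards [h.eventually_le_const one_pos, eventually_gt_atTop 0] with w hw hw0
  rw [← one_div, le_div_iff₀ (by positivity)]
  refine le_of_eq_of_le ?_ hw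
  ring

/-- The remainder over a block of `k` observations exceeds `ε / √k` only with a probability that
decays faster than a large power of `k`. -/
theorem eventually_bahadurRemainder_tail_le (hmeas : ∀ t, Measurable (X t))
    (hindep : iIndepFun X μ) (hident : ∀ t, IdentDistrib (X t) (X 1) μ μ)
    (hF : ∀ x, F x = μ.real {ω | X 1 ω ≤ x}) (hd : Differentiable ℝ F)
    (hd2 : Differentiable ℝ (deriv F)) {B : ℝ} (hB1 : ∀ x, |deriv F x| ≤ B)
    (hB2 : ∀ x, |deriv (deriv F) x| ≤ B) {β : ℝ} (hβ0 : 0 < β) (hβ1 : β < 1)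
    (hf : 0 < deriv F (quantile β F)) {ε : ℝ} (hε : 0 < ε) :
    ∀ᶠ k : ℝ in atTop, ∀ i j : ℤ, i < j → (j : ℝ) - i + 1 = k →
      μ.real {ω | ε / √k < |bahadurRemainder F β (fun t => X t ω) i j|} ≤ (k ^ 11)⁻¹ := by
  have h1 := eventually_exp_bound_le (B * (1 / deriv F (quantile β F) + ε))
    (by positivity : 0 < deriv F (quantile β F) * ε / 2)
  have h2 : ∀ᶠ w : ℝ in atTop,
      2 * (B * (1 / deriv F (quantile β F) + ε) ^ 2) ≤ deriv F (quantile β F) * ε * w ^ 2 :=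
    ((tendsto_pow_atTop two_ne_zero).const_mul_atTop
      (by positivity : 0 < deriv F (quantile β F) * ε)).eventually_ge_atTop _
  have ht := tendsto_rpow_atTop (by norm_num : (0 : ℝ) < 1 / 8)
  filter_upwards [ht.eventually h1, ht.eventually h2, ht.eventually_ge_atTop 1,
    eventually_ge_atTop 0] with k hk1 hk2 hk3 hk0 i j hij hk
  set w := k ^ (1 / 8 : ℝ)
  have hw : w ^ 8 = k := by
    rw [← Real.rpow_natCast, ← Real.rpow_mul hk0]; norm_num
  have hsqrt : √k = w ^ 4 := by
    rw [← hw, show w ^ 8 = (w ^ 4) ^ 2 by ring, Real.sqrt_sq (by positivity)]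
  rw [hsqrt, show k ^ 11 = w ^ 88 by rw [← hw, ← pow_mul]]
  exact (bahadurRemainder_tail_le hmeas hindep hident hF hd hd2 hB1 hB2 hβ0 hβ1 hf hε hk3 hk2 hij
    (hk.trans hw.symm)).trans hk1

end

/-! ### The weighted maximum -/

theorem exists_of_le_maxWeightedRemainder {F : ℝ → ℝ} {β : ℝ} {x : ℤ → ℝ} {n : ℕ} {a : ℝ}
    (ha : 0 < a) (h : a ≤ |maxWeightedRemainder F β x n|) :
    ∃ i j : ℤ, 1 ≤ i ∧ i < j ∧ j ≤ n ∧
      a ≤ ((j : ℝ) - i + 1) * |bahadurRemainder F β x i j| := by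
  unfold maxWeightedRemainder at h
  set S : Set (ℤ × ℤ) := {p : ℤ × ℤ | 1 ≤ p.1 ∧ p.1 < p.2 ∧ p.2 ≤ (n : ℤ)}
  have hfin : S.Finite := (Set.finite_Icc ((1, 1) : ℤ × ℤ) (n, n)).subset fun p hp =>
    ⟨⟨hp.1, by have := hp.1; have := hp.2.1; show (1 : ℤ) ≤ p.2; omega⟩,
      ⟨by have := hp.2.2; have := hp.2.1; show p.1 ≤ (n : ℤ); omega, hp.2.2⟩⟩
  rcases S.eq_empty_or_nonempty with hS | hS
  · rw [hS, Set.image_empty, Real.sSup_empty, abs_zero] at h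
    exact absurd h (not_le.2 ha)
  · obtain ⟨⟨i, j⟩, ⟨h1, h2, h3⟩, hp⟩ := (hS.image fun p : ℤ × ℤ =>
      ((p.2 : ℝ) - (p.1 : ℝ) + 1) * |bahadurRemainder F β x p.1 p.2|).csSup_mem (hfin.image _)
    rw [← hp] at h
    have : (i : ℝ) < j := by exact_mod_cast h2
    refine ⟨i, j, h1, h2, h3, ?_⟩
    rwa [abs_of_nonneg (mul_nonneg (by simp only; linarith) (abs_nonneg _))] at h

section

variable {Ω : Type*} [MeasurableSpace Ω] {μ : Measure Ω} {X : ℤ → Ω → ℝ}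
  {F : ℝ → ℝ}

theorem measureReal_exists_lt_abs_le (hident : ∀ t, IdentDistrib (X t) (X 1) μ μ) (n : ℕ)
    (a : ℝ) : μ.real (⋃ t ∈ Finset.Icc (1 : ℤ) n, {ω | a < |X t ω|})
      ≤ n * μ.real {ω | a < |X 1 ω|} := by
  refine (measureReal_biUnion_finset_le _ _).trans
    ((Finset.sum_le_card_nsmul _ _ (μ.real {ω | a < |X 1 ω|}) fun t _ => ?_).trans_eq ?_)
  · have hm : MeasurableSet {y : ℝ | a < |y|} := measurableSet_lt measurable_const (by fun_prop)
    exact (congrArg ENNReal.toReal ((hident t).measure_mem_eq hm)).le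
  · rw [nsmul_eq_mul, Int.card_Icc]
    simp

/-- At most `n² = v ^ 10` pairs, each of probability at most `v ^ (-11)`. -/
theorem measureReal_long_blocks_le {ε v : ℝ} {β : ℝ} (hv : 1 ≤ v)
    (htail : ∀ k : ℝ, v ≤ k → ∀ i j : ℤ, i < j → (j : ℝ) - i + 1 = k →
      μ.real {ω | ε / √k < |bahadurRemainder F β (fun t => X t ω) i j|} ≤ (k ^ 11)⁻¹)
    {n : ℕ} (hn : (n : ℝ) = v ^ 5) :
    μ.real (⋃ p ∈ (Finset.Icc (1 : ℤ) n ×ˢ Finset.Icc (1 : ℤ) n).filter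
        (fun p => p.1 < p.2 ∧ v ≤ (p.2 : ℝ) - p.1 + 1),
      {ω | ε / √((p.2 : ℝ) - p.1 + 1) < |bahadurRemainder F β (fun t => X t ω) p.1 p.2|})
      ≤ v⁻¹ := by
  have hv0 : 0 < v := by linarith
  refine (measureReal_biUnion_finset_le _ _).trans
    ((Finset.sum_le_card_nsmul _ _ ((v ^ 11)⁻¹) fun p hp => ?_).trans ?_)
  · obtain ⟨-, h1, h2⟩ := Finset.mem_filter.1 hp
    refine (htail _ h2 _ _ h1 rfl).trans ?_
    gcongr
  · have hc : (((Finset.Icc (1 : ℤ) n ×ˢ Finset.Icc (1 : ℤ) n).filter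
        (fun p => p.1 < p.2 ∧ v ≤ (p.2 : ℝ) - p.1 + 1)).card : ℝ) ≤ v ^ 10 := by
      have h := Finset.card_filter_le (Finset.Icc (1 : ℤ) n ×ˢ Finset.Icc (1 : ℤ) n)
        (fun p => p.1 < p.2 ∧ v ≤ (p.2 : ℝ) - p.1 + 1)
      rw [Finset.card_product, Int.card_Icc, show ((n : ℤ) + 1 - 1).toNat = n by simp] at h
      calc _ ≤ ((n * n : ℕ) : ℝ) := by exact_mod_cast h
        _ = v ^ 10 := by push_cast; rw [hn]; ring
    rw [nsmul_eq_mul]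
    calc _ ≤ v ^ 10 * (v ^ 11)⁻¹ := by gcongr
      _ = v⁻¹ := by field_simp

end

theorem mainTheorem6 {Ω : Type*} [MeasurableSpace Ω] (μ : Measure Ω) [IsProbabilityMeasure μ]
    (X : ℤ → Ω → ℝ)
    (hmeas : ∀ t, Measurable (X t))
    (hindep : iIndepFun X μ)
    (hident : ∀ t, IdentDistrib (X t) (X 1) μ μ)
    (F : ℝ → ℝ)
    (hF : ∀ x, F x = μ.real {ω | X 1 ω ≤ x})
    (hdiff : Differentiable ℝ F)
    (hdiff2 : Differentiable ℝ (deriv F))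
    (hbdd : BddAbove (Set.range fun x => deriv F x + |deriv (deriv F) x|))
    (lam : ℝ) (hlam : 18 / 5 < lam)
    (htail : ∃ C : ℝ, ∀ x : ℝ, 0 < x → μ.real {ω | x < |X 1 ω|} ≤ C * x ^ (-lam))
    (β : ℝ) (hβ0 : 0 < β) (hβ1 : β < 1)
    (hpos : 0 < deriv F (quantile β F)) :
    TendstoInMeasure μ
      (fun (n : ℕ) ω => 1 / Real.sqrt n * maxWeightedRemainder F β (fun t => X t ω) n)
      atTop (fun _ => (0 : ℝ)) := by
  obtain ⟨C, hC⟩ := htail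
  obtain ⟨B, hB⟩ := hbdd
  have hB' : ∀ x, deriv F x + |deriv (deriv F) x| ≤ B := fun x => hB ⟨x, rfl⟩
  have hf0 : ∀ x, 0 ≤ deriv F x := fun x => (monotone_of_eq_measureReal hF).deriv_nonneg
  have hB1 : ∀ x, |deriv F x| ≤ B := fun x => by
    rw [abs_of_nonneg (hf0 x)]; linarith [hB' x, abs_nonneg (deriv (deriv F) x)]
  have hB2 : ∀ x, |deriv (deriv F) x| ≤ B := fun x => by linarith [hB' x, hf0 x]
  rw [tendstoInMeasure_iff_measureReal_norm]
  intro ε hε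
  obtain ⟨K, hK⟩ := eventually_atTop.1 (eventually_bahadurRemainder_tail_le hmeas hindep hident hF
    hdiff hdiff2 hB1 hB2 hβ0 hβ1 hpos (half_pos hε))
  set c := |quantile β F| + 1 / deriv F (quantile β F) with hc
  have hroot : Tendsto (fun n : ℕ => (n : ℝ) ^ (1 / 5 : ℝ)) atTop atTop :=
    (tendsto_rpow_atTop (by norm_num)).comp tendsto_natCast_atTop_atTop
  have hroot3 : Tendsto (fun n : ℕ => (n : ℝ) ^ (3 / 10 : ℝ)) atTop atTop :=
    (tendsto_rpow_atTop (by norm_num)).comp tendsto_natCast_atTop_atTop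
  have hbound : Tendsto (fun n : ℕ => C * (ε / 2) ^ (-lam) * (n : ℝ) ^ (-(3 / 10 * lam - 1))
      + ((n : ℝ) ^ (1 / 5 : ℝ))⁻¹) atTop (𝓝 0) := by
    -- Only `lam > 10 / 3` is used here, which `18 / 5 < lam` implies.
    have h := (((tendsto_rpow_neg_atTop (by linarith : 0 < 3 / 10 * lam - 1)).comp
      tendsto_natCast_atTop_atTop).const_mul (C * (ε / 2) ^ (-lam))).add
      (tendsto_inv_atTop_zero.comp hroot)
    rw [mul_zero, add_zero] at h
    exact h
  refine squeeze_zero' (Eventually.of_forall fun _ => measureReal_nonneg) ?_ hbound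
  filter_upwards [hroot.eventually_ge_atTop (max K 1),
    (hroot3.const_mul_atTop (half_pos hε)).eventually_gt_atTop c, eventually_gt_atTop 0]
    with n hn1 hn2 hn0
  have hn0' : (0 : ℝ) < n := by exact_mod_cast hn0
  set v := (n : ℝ) ^ (1 / 5 : ℝ) with hv
  have hv1 : 1 ≤ v := (le_max_right _ _).trans hn1
  have hvK : K ≤ v := (le_max_left _ _).trans hn1
  have hvn : (n : ℝ) = v ^ 5 := by
    rw [hv, ← Real.rpow_natCast, ← Real.rpow_mul hn0'.le]; norm_num
  set z := (n : ℝ) ^ (3 / 10 : ℝ) with hz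
  have hz0 : 0 < z := Real.rpow_pos_of_pos hn0' _
  -- `3/10 + 1/5 = 1/2`: the bound on the observations times the cut-off length is of order `√n`.
  have hzv : √n = z * v := by
    rw [hz, hv, ← Real.rpow_add hn0', Real.sqrt_eq_rpow]; norm_num
  have hsub : {ω | ε ≤ ‖1 / √n * maxWeightedRemainder F β (fun t => X t ω) n - 0‖} ⊆
      (⋃ t ∈ Finset.Icc (1 : ℤ) n, {ω | ε / 2 * z < |X t ω|}) ∪
      ⋃ p ∈ (Finset.Icc (1 : ℤ) n ×ˢ Finset.Icc (1 : ℤ) n).filter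
        (fun p => p.1 < p.2 ∧ v ≤ (p.2 : ℝ) - p.1 + 1),
      {ω | ε / 2 / √((p.2 : ℝ) - p.1 + 1)
        < |bahadurRemainder F β (fun t => X t ω) p.1 p.2|} := by
    intro ω hω
    have hsn : 0 < √(n : ℝ) := Real.sqrt_pos.2 hn0'
    have hω' : ε * √n ≤ |maxWeightedRemainder F β (fun t => X t ω) n| := by
      have h : ε ≤ ‖1 / √n * maxWeightedRemainder F β (fun t => X t ω) n - 0‖ := hω
      rwa [sub_zero, norm_mul, Real.norm_eq_abs, Real.norm_eq_abs, abs_of_pos (by positivity),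
        one_div, ← div_eq_inv_mul, le_div_iff₀ hsn] at h
    obtain ⟨i, j, hi, hij, hj, h⟩ := exists_of_le_maxWeightedRemainder (by positivity) hω'
    have hij' : (i : ℝ) < j := by exact_mod_cast hij
    set k := (j : ℝ) - i + 1 with hk
    have hk0 : 0 < k := by linarith
    have hkn : k ≤ n := by
      have h1 : (1 : ℝ) ≤ i := by exact_mod_cast hi
      have h2 : (j : ℝ) ≤ n := by exact_mod_cast hj
      linarith
    by_contra hnot
    simp only [Set.mem_union, Set.mem_iUnion, Set.mem_ofPred_eq, not_or, not_exists, not_lt]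
      at hnot
    obtain ⟨hX, hR⟩ := hnot
    rcases le_or_gt v k with hvk | hvk
    · have h1 := hR (i, j) (Finset.mem_filter.2 ⟨Finset.mem_product.2
        ⟨Finset.mem_Icc.2 ⟨hi, by simp only; omega⟩, Finset.mem_Icc.2 ⟨by simp only; omega, hj⟩⟩,
        hij, hvk⟩)
      have h2 : k * |bahadurRemainder F β (fun t => X t ω) i j| ≤ ε / 2 * √k := by
        calc _ ≤ k * (ε / 2 / √k) := by gcongr
          _ = ε / 2 * √k := by
            have : √k * √k = k := Real.mul_self_sqrt hk0.le
            have : 0 < √k := Real.sqrt_pos.2 hk0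
            field_simp
            nlinarith
      -- The spare factor `1/2` gives the strict contradiction with `ε * √n`.
      have h3 : ε / 2 * √k ≤ ε / 2 * √n := by gcongr
      nlinarith
    · have h1 := abs_bahadurRemainder_le (x := fun t => X t ω) hij hβ0 hβ1 hpos
        (B := ε / 2 * z) fun t ht => hX t (Finset.mem_Icc.2
          ⟨hi.trans (Finset.mem_Icc.1 ht).1, (Finset.mem_Icc.1 ht).2.trans hj⟩)
      have h2 : |bahadurRemainder F β (fun t => X t ω) i j| < ε * z := by linarith
      have h3 : k * |bahadurRemainder F β (fun t => X t ω) i j| < v * (ε * z) :=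
        mul_lt_mul'' hvk h2 hk0.le (abs_nonneg _)
      rw [hzv] at h
      linarith
  refine (measureReal_mono hsub (measure_ne_top _ _)).trans ((measureReal_union_le _ _).trans
    (add_le_add ?_ (measureReal_long_blocks_le hv1 (fun k hk => hK k (hvK.trans hk)) hvn)))
  refine (measureReal_exists_lt_abs_le hident n _).trans
    ((mul_le_mul_of_nonneg_left (hC _ (by positivity)) hn0'.le).trans_eq ?_)
  rw [Real.mul_rpow (half_pos hε).le hz0.le, hz, ← Real.rpow_mul hn0'.le,
    show -(3 / 10 * lam - 1) = 1 + 3 / 10 * -lam by ring, Real.rpow_add hn0', Real.rpow_one]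
  ring
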